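/- Let $G$ be a finite simple undirected graph of order $n$, maximum degree $\Delta>0$ and clique number $\omega$ (the maximum size of a set of pairwise adjacent vertices). Let $a(G)$ denote the maximum size of a set $S$ of vertices of $G$ such that the induced subgraph $G[S]$ is a forest. Then \[ a(G) \;\ge\; \frac{6n}{2\Delta+\omega+2}. \] The bound is sharp for cliques: if $G$ is a complete graph (with $\Delta>0$, i.e. $n\ge 2$), then $a(G)=\dfrac{6n}{2\Delta+\omega+2}$. -/

import Mathlib

/-- A set `S` of vertices is acyclic in `G` if the induced subgraph `G[S]` is a forest. -/
def IsAcyclicSet {V : Type*} (G : SimpleGraph V) (S : Finset V) : Prop :=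
  (G.induce (S : Set V)).IsAcyclic

/-- `a(G)`: the maximum size of an acyclic set of `G`. (For finite `V` the set of sizes is
nonempty and bounded, so the supremum is attained.) -/
noncomputable def acyclicNumber {V : Type*} (G : SimpleGraph V) : ℕ :=
  sSup {k : ℕ | ∃ S : Finset V, IsAcyclicSet G S ∧ S.card = k}

/-! A set induces a forest exactly when it contains no core, that is, no nonempty subset of minimum
degree at least two. Take a largest core-free `S`, with non-isolated part `N`, and let d(v) count
the neighbours of v in `S`. Exchange arguments show that every outer vertex has at least two
neighbours in `N`, and that the neighbours of r ∈ `N` in an attached set `Q` form a clique together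
with r. So r has at most ω - 1 of them, and discharging along leaves gives 2|Q| ≤ Σ_N (2d + ω - 4)
(`IsAttached.sum_charge_nonneg`). `Q` can be chosen with |Q| = |P| + |B|: `P` is the outer vertices
with d = 2, and `B` the isolated vertices of `S` having an outer neighbour with d = 3. Counting
degrees over `S`, each outer vertex contributes at least 3, except for a loss of 1 on `P`. Every
isolated vertex outside `B` gains 1: it has degree below Δ, or all its outer neighbours have d ≥ 4.
The two estimates add up to 6n ≤ (2Δ + ω + 2)|S|. -/

namespace SimpleGraph

open Finset

variable {V : Type*}

/-- Every vertex of `A` has at least two neighbours inside `A`. -/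
def IsCore (G : SimpleGraph V) (A : Finset V) : Prop :=
  ∀ v ∈ A, ∃ y ∈ A, ∃ z ∈ A, y ≠ z ∧ G.Adj v y ∧ G.Adj v z

/-- `S` contains no nonempty subset in which all degrees are at least two. -/
def IsCoreFree (G : SimpleGraph V) (S : Finset V) : Prop :=
  ∀ A ⊆ S, G.IsCore A → A = ∅

/-- A core-free set of maximum size. -/
structure IsMaxCoreFree (G : SimpleGraph V) (S : Finset V) : Prop where
  coreFree : G.IsCoreFree S
  card_le : ∀ T, G.IsCoreFree T → #T ≤ #S

/-- The vertices of `S` that are not isolated in the subgraph induced on `S`. -/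
def nonisolated (G : SimpleGraph V) [DecidableRel G.Adj] (S : Finset V) : Finset V :=
  {r ∈ S | ∃ y ∈ S, G.Adj r y}

/-- Vertices outside `S` with exactly two non-isolated neighbours in `S`, no two of which share an
isolated neighbour in `S`. -/
structure IsAttached (G : SimpleGraph V) [DecidableRel G.Adj] (S Q : Finset V) : Prop where
  notMem : ∀ u ∈ Q, u ∉ S
  card_eq_two : ∀ u ∈ Q, #{r ∈ G.nonisolated S | G.Adj u r} = 2
  eq_of_adj : ∀ x ∈ S, (∀ y ∈ S, ¬ G.Adj x y) → ∀ u ∈ Q, ∀ w ∈ Q, G.Adj x u → G.Adj x w → u = w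

/-! ### Cores and maximum core-free sets -/

variable {G : SimpleGraph V} {S Q A : Finset V} {r u w x y m : V}

/-- The peeling step: applied repeatedly, it strips a supposed core of all its vertices. -/
theorem IsCore.notMem (hA : G.IsCore A) (v w : V) (h : ∀ z ∈ A, G.Adj v z → z = w) : v ∉ A := by
  intro hv
  obtain ⟨y, hy, z, hz, hne, h1, h2⟩ := hA v hv
  exact hne ((h y hy h1).trans (h z hz h2).symm)

theorem mem_nonisolated [DecidableRel G.Adj] :
    r ∈ G.nonisolated S ↔ r ∈ S ∧ ∃ y ∈ S, G.Adj r y := by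
  simp [nonisolated]

theorem exists_isMaxCoreFree [Fintype V] (G : SimpleGraph V) : ∃ S, G.IsMaxCoreFree S := by
  classical
  obtain ⟨S, hS, hmax⟩ := Finset.exists_max_image (Finset.univ.filter fun S => G.IsCoreFree S)
    Finset.card ⟨∅, Finset.mem_filter.2 ⟨Finset.mem_univ _, fun A hA _ => Finset.subset_empty.1 hA⟩⟩
  exact ⟨S, by simpa using hS, fun T hT => hmax T (by simpa using hT)⟩

variable [DecidableEq V]

/-- The support of a cycle is a core. -/
theorem IsCoreFree.isAcyclicSet (hS : G.IsCoreFree S) : IsAcyclicSet G S := by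
  intro v c hc
  have hA := hS (c.support.toFinset.map (Function.Embedding.subtype _)) (by
    intro a ha
    simp only [Finset.mem_map, Function.Embedding.subtype_apply] at ha
    obtain ⟨b, -, rfl⟩ := ha
    exact b.2) (by
    intro a ha
    simp only [Finset.mem_map, Function.Embedding.subtype_apply, List.mem_toFinset] at ha
    obtain ⟨b, hb, rfl⟩ := ha
    have h2 := hc.ncard_neighborSet_toSubgraph_eq_two hb
    obtain ⟨y, z, hyz, he⟩ := Set.ncard_eq_two.1 h2
    have hy : c.toSubgraph.Adj b y := by
      rw [← Subgraph.mem_neighborSet, he]; simp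
    have hz : c.toSubgraph.Adj b z := by
      rw [← Subgraph.mem_neighborSet, he]; simp
    refine ⟨y, ?_, z, ?_, fun h => hyz (Subtype.ext h), hy.adj_sub, hz.adj_sub⟩
    · have := hy.snd_mem
      simpa using this
    · have := hz.snd_mem
      simpa using this)
  have : (v : V) ∈ (∅ : Finset V) := by
    rw [← hA]; simp
  simp at this

theorem IsMaxCoreFree.exists_core_insert (hS : G.IsMaxCoreFree S) (hu : u ∉ S) :
    ∃ A ⊆ insert u S, G.IsCore A ∧ u ∈ A := by
  have h : ¬ G.IsCoreFree (insert u S) := fun h => by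
    have := hS.card_le _ h
    rw [card_insert_of_notMem hu] at this
    omega
  simp only [IsCoreFree] at h
  push Not at h
  obtain ⟨A, hA, hc, hne⟩ := h
  refine ⟨A, hA, hc, ?_⟩
  by_contra huA
  exact hne.ne_empty (hS.coreFree A ((Finset.subset_insert_iff_of_notMem huA).1 hA) hc)

/-- The exchanged set has |S| + 1 vertices, so it has a core, which cannot lie within `S`. -/
theorem IsMaxCoreFree.exists_core_swap (hS : G.IsMaxCoreFree S) (hr : r ∈ S) (hu : u ∉ S)
    (hw : w ∉ S) (huw : u ≠ w) :
    ∃ A ⊆ insert u (insert w (S.erase r)), G.IsCore A ∧ (u ∈ A ∨ w ∈ A) := by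
  have h : ¬ G.IsCoreFree (insert u (insert w (S.erase r))) := fun h => by
    have := hS.card_le _ h
    rw [card_insert_of_notMem (by simp [hu, huw]), card_insert_of_notMem (by simp [hw]),
      card_erase_of_mem hr] at this
    have := card_pos.2 ⟨r, hr⟩
    omega
  simp only [IsCoreFree] at h
  push Not at h
  obtain ⟨A, hA, hc, hne⟩ := h
  refine ⟨A, hA, hc, ?_⟩
  by_contra! h
  refine hne.ne_empty (hS.coreFree A (fun a ha => ?_) hc)
  have := hA ha
  grind

/-! ### Exchange arguments for attached vertices -/

variable [DecidableRel G.Adj]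

/-- In such a core `x` could only be adjacent to `u` and `w`, and `eq_of_adj` excludes two distinct
ones. -/
theorem IsAttached.notMem_core (hQ : G.IsAttached S Q) (hu : u ∈ Q) (hw : w ∈ Q)
    (hA : G.IsCore A) (hAS : A ⊆ insert u (insert w S)) (hx : x ∈ S)
    (hi : x ∉ G.nonisolated S) : x ∉ A := by
  have hi' : ∀ y ∈ S, ¬ G.Adj x y := fun y hy h => hi (mem_nonisolated.2 ⟨hx, y, hy, h⟩)
  have key := hQ.eq_of_adj x hx hi'
  intro hxA
  obtain ⟨y, hy, z, hz, hne, h1, h2⟩ := hA x hxA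
  have := hAS hy
  have := hAS hz
  grind

theorem IsAttached.exists_pair (hQ : G.IsAttached S Q) (hu : u ∈ Q) :
    ∃ a b, a ≠ b ∧ ∀ r ∈ G.nonisolated S, G.Adj u r ↔ r = a ∨ r = b := by
  obtain ⟨a, b, hab, h⟩ := Finset.card_eq_two.1 (hQ.card_eq_two u hu)
  refine ⟨a, b, hab, fun r hr => ?_⟩
  have := Finset.ext_iff.1 h r
  simp only [mem_filter, hr, true_and, mem_insert, mem_singleton] at this
  exact this

/-- Attached vertices with a common non-isolated neighbour are adjacent. -/
theorem IsAttached.adj (hQ : G.IsAttached S Q) (hS : G.IsMaxCoreFree S)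
    (hr : r ∈ G.nonisolated S) (hu : u ∈ Q) (hw : w ∈ Q) (huw : u ≠ w)
    (hur : G.Adj r u) (hwr : G.Adj r w) : G.Adj u w := by
  by_contra hn
  -- Once `r` is gone, the nonadjacent `u` and `w` each keep only one non-isolated neighbour, so
  -- both peel off.
  obtain ⟨A, hA, hc, hmem⟩ := hS.exists_core_swap (mem_nonisolated.1 hr).1
    (hQ.notMem u hu) (hQ.notMem w hw) huw
  have hiso := fun x => hQ.notMem_core (x := x) hu hw hc (by grind)
  have hn' : ¬ G.Adj w u := fun h => hn h.symm
  have aux : ∀ v ∈ Q, G.Adj r v → ¬ G.Adj v u → ¬ G.Adj v w → v ∉ A := by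
    intro v hv hvr h1 h2
    obtain ⟨a, b, hab, h⟩ := hQ.exists_pair hv
    have h3 := (h r hr).1 hvr.symm
    refine hc.notMem v (if r = a then b else a) fun z hz hvz => ?_
    have := hA hz
    have := hiso z
    grind
  have := aux u hu hur (by simp) hn
  have := aux w hw hwr hn' (by simp)
  tauto

/-- An attached vertex adjacent to a component of `S` with two vertices is adjacent to both. -/
theorem IsAttached.adj_of_edge (hQ : G.IsAttached S Q) (hS : G.IsMaxCoreFree S)
    (hxS : x ∈ S) (hyS : y ∈ S) (hxy : G.Adj x y) (hx : ∀ z ∈ S, G.Adj x z → z = y)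
    (hy : ∀ z ∈ S, G.Adj y z → z = x) (hu : u ∈ Q) (hux : G.Adj x u) : G.Adj y u := by
  by_contra hn
  obtain ⟨A, hA, hc, hmem⟩ := hS.exists_core_insert (hQ.notMem u hu)
  have hiso := fun v => hQ.notMem_core (x := v) hu hu hc (by grind)
  have h1 : y ∉ A := hc.notMem y x fun z hz h => by
    have := hA hz
    grind
  have h2 : x ∉ A := hc.notMem x u fun z hz h => by
    have := hA hz
    grind
  obtain ⟨a, b, hab, h⟩ := hQ.exists_pair hu
  have h3 := (h x (mem_nonisolated.2 ⟨hxS, y, hyS, hxy⟩)).1 hux.symm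
  refine hc.notMem u (if x = a then b else a) (fun z hz huz => ?_) hmem
  have := hA hz
  have := hiso z
  have : z ≠ u := huz.ne'
  grind

/-- An attached vertex adjacent to a component of `S` that is a path on three vertices has two
neighbours in it. -/
theorem IsAttached.adj_of_path (hQ : G.IsAttached S Q) (hS : G.IsMaxCoreFree S)
    (hxS : x ∈ S) (hmS : m ∈ S) (hxm : G.Adj x m) (hx : ∀ z ∈ S, G.Adj x z → z = m)
    (hy : ∀ z ∈ S, G.Adj y z → z = m) (hm : ∀ z ∈ S, G.Adj m z → z = x ∨ z = y) (hu : u ∈ Q) :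
    (G.Adj x u → G.Adj m u ∨ G.Adj y u) ∧ (G.Adj m u → G.Adj x u ∨ G.Adj y u) := by
  obtain ⟨A, hA, hc, hmem⟩ := hS.exists_core_insert (hQ.notMem u hu)
  have hiso := fun v => hQ.notMem_core (x := v) hu hu hc (by grind)
  obtain ⟨a, b, hab, h⟩ := hQ.exists_pair hu
  have hxN := h x (mem_nonisolated.2 ⟨hxS, m, hmS, hxm⟩)
  have hmN := h m (mem_nonisolated.2 ⟨hmS, x, hxS, hxm.symm⟩)
  constructor
  · intro hux
    by_contra! hn
    have h1 : y ∉ A := hc.notMem y m fun z hz h => by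
      have := hA hz
      grind
    have h2 : m ∉ A := hc.notMem m x fun z hz h => by
      have := hA hz
      grind
    have h3 : x ∉ A := hc.notMem x u fun z hz h => by
      have := hA hz
      grind
    have h4 := hxN.1 hux.symm
    refine hc.notMem u (if x = a then b else a) (fun z hz huz => ?_) hmem
    have := hA hz
    have := hiso z
    have : z ≠ u := huz.ne'
    grind
  · intro hum
    by_contra! hn
    have h1 : y ∉ A := hc.notMem y m fun z hz h => by
      have := hA hz
      grind
    have h2 : x ∉ A := hc.notMem x m fun z hz h => by
      have := hA hz
      grind
    have h3 : m ∉ A := hc.notMem m u fun z hz h => by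
      have := hA hz
      grind
    have h4 := hmN.1 hum.symm
    refine hc.notMem u (if m = a then b else a) (fun z hz huz => ?_) hmem
    have := hA hz
    have := hiso z
    have : z ≠ u := huz.ne'
    grind

/-- The two edges of a component of `S` that is a path on three vertices do not both lie in
triangles with attached vertices. -/
theorem IsAttached.not_adj_both_of_path (hQ : G.IsAttached S Q) (hS : G.IsMaxCoreFree S)
    (hxS : x ∈ S) (hmS : m ∈ S) (hyS : y ∈ S) (hxy : x ≠ y) (hxm : G.Adj x m)
    (hym : G.Adj y m) (hx : ∀ z ∈ S, G.Adj x z → z = m) (hy : ∀ z ∈ S, G.Adj y z → z = m)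
    (hu : u ∈ Q) (hw : w ∈ Q) (hux : G.Adj x u)
    (hum : G.Adj m u) (hwm : G.Adj m w) (hwy : G.Adj y w) : False := by
  have hxN := mem_nonisolated.2 ⟨hxS, m, hmS, hxm⟩
  have hyN := mem_nonisolated.2 ⟨hyS, m, hmS, hym⟩
  have hmN := mem_nonisolated.2 ⟨hmS, x, hxS, hxm.symm⟩
  obtain ⟨a, b, hab, h⟩ := hQ.exists_pair hu
  obtain ⟨a', b', hab', h'⟩ := hQ.exists_pair hw
  have e1 := (h x hxN).1 hux.symm
  have e2 := (h m hmN).1 hum.symm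
  have e3 := (h' m hmN).1 hwm.symm
  have e4 := (h' y hyN).1 hwy.symm
  have hmx := hxm.ne
  have hmy := hym.ne
  have huy : ¬ G.Adj y u := fun hh => by
    have := (h y hyN).1 hh.symm
    grind
  have hwx : ¬ G.Adj x w := fun hh => by
    have := (h' x hxN).1 hh.symm
    grind
  have huw : u ≠ w := fun hh => by subst hh; exact huy hwy
  -- Without `m`, the vertex `x` hangs on `u` alone and `y` on `w` alone; after peeling these, `u`
  -- and `w` have at most each other.
  obtain ⟨A, hA, hc, hmem⟩ := hS.exists_core_swap hmS (hQ.notMem u hu) (hQ.notMem w hw) huw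
  have hiso := fun x => hQ.notMem_core (x := x) hu hw hc (by grind)
  have h1 : x ∉ A := hc.notMem x u fun z hz h => by
    have := hA hz
    grind
  have h2 : y ∉ A := hc.notMem y w fun z hz h => by
    have := hA hz
    grind
  have h3 : u ∉ A := hc.notMem u w fun z hz huz => by
    have := hA hz
    have := hiso z
    have : z ≠ u := huz.ne'
    grind
  have h4 : w ∉ A := hc.notMem w u fun z hz huz => by
    have := hA hz
    have := hiso z
    have : z ≠ w := huz.ne'
    grind
  tauto

end SimpleGraph

/-! ### Clique bounds and discharging -/

namespace SimpleGraph

open Finset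

variable {V : Type*} {G : SimpleGraph V} [DecidableRel G.Adj]
  {S Q : Finset V} {r x y m : V}

theorem IsAttached.sum_card_adj (hQ : G.IsAttached S Q) :
    ∑ r ∈ G.nonisolated S, #{u ∈ Q | G.Adj r u} = 2 * #Q := by
  have := sum_card_bipartiteAbove_eq_sum_card_bipartiteBelow (s := G.nonisolated S) (t := Q) G.Adj
  simp only [bipartiteAbove, bipartiteBelow] at this
  rw [this, sum_congr rfl (g := fun _ => 2)]
  · simp [mul_comm]
  · intro u hu
    rw [← hQ.card_eq_two u hu]
    simp [G.adj_comm]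

variable [DecidableEq V]

/-- In the core of `insert v S`, an isolated vertex of `S` would have `v` as its only neighbour. -/
theorem IsMaxCoreFree.two_le_card_nonisolated (hS : G.IsMaxCoreFree S) {v : V} (hv : v ∉ S) :
    2 ≤ #{r ∈ G.nonisolated S | G.Adj v r} := by
  obtain ⟨A, hA, hc, hmem⟩ := hS.exists_core_insert hv
  have hsub : ∀ z ∈ A, G.Adj v z → z ∈ G.nonisolated S := by
    intro z hz hvz
    by_contra hn
    have hzS : z ∈ S := by
      have := hA hz
      have := hvz.ne'
      grind
    refine hc.notMem z v (fun t ht hzt => ?_) hz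
    by_contra htv
    exact hn (mem_nonisolated.2 ⟨hzS, t, by grind, hzt⟩)
  obtain ⟨y, hy, z, hz, hne, h1, h2⟩ := hc v hmem
  refine Finset.one_lt_card.2 ⟨y, ?_, z, ?_, hne⟩ <;> simp [*]

/-- The nonisolated neighbours together with the isolated ones make up all neighbours in `S`. -/
theorem card_filter_nonisolated_add (S : Finset V) (v : V) :
    #{r ∈ G.nonisolated S | G.Adj v r} + #{x ∈ S \ G.nonisolated S | G.Adj v x} =
      #{r ∈ S | G.Adj v r} := by
  rw [← card_union_of_disjoint (disjoint_filter_filter disjoint_sdiff), ← filter_union,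
    union_sdiff_of_subset (show G.nonisolated S ⊆ S from filter_subset _ _)]

variable [Fintype V]

theorem IsAttached.card_adj_lt_cliqueNum (hQ : G.IsAttached S Q) (hS : G.IsMaxCoreFree S)
    (hr : r ∈ G.nonisolated S) : #{u ∈ Q | G.Adj r u} + 1 ≤ G.cliqueNum := by
  rw [← card_insert_of_notMem (a := r) (by simp)]
  refine IsClique.card_le_cliqueNum (tc := ?_)
  simp only [coe_insert, coe_filter]
  refine (isClique_insert).2 ⟨?_, fun u hu _ => hu.2⟩
  intro u hu w hw huw
  exact hQ.adj hS hr hu.1 hw.1 huw hu.2 hw.2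

theorem IsAttached.card_adj_add_two_le_of_edge (hQ : G.IsAttached S Q) (hS : G.IsMaxCoreFree S)
    (hxS : x ∈ S) (hyS : y ∈ S) (hxy : G.Adj x y) (hx : ∀ z ∈ S, G.Adj x z → z = y)
    (hy : ∀ z ∈ S, G.Adj y z → z = x) : #{u ∈ Q | G.Adj x u} + 2 ≤ G.cliqueNum := by
  have hyQ : y ∉ Q := fun h => hQ.notMem y h hyS
  rw [show #{u ∈ Q | G.Adj x u} + 2 = #{u ∈ Q | G.Adj x u} + 1 + 1 from rfl,
    ← card_insert_of_notMem (a := y) (s := {u ∈ Q | G.Adj x u}) (by simp [hyQ]),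
    ← card_insert_of_notMem (a := x) (by simp [hxy.ne])]
  refine IsClique.card_le_cliqueNum (tc := ?_)
  simp only [coe_insert, coe_filter]
  refine isClique_insert.2 ⟨isClique_insert.2 ⟨?_, fun u hu _ => ?_⟩, fun u hu _ => ?_⟩
  · intro u hu w hw huw
    exact hQ.adj hS (mem_nonisolated.2 ⟨hxS, y, hyS, hxy⟩) hu.1 hw.1 huw hu.2 hw.2
  · exact hQ.adj_of_edge hS hxS hyS hxy hx hy hu.1 hu.2
  · rcases hu with rfl | hu
    exacts [hxy, hu.2]

theorem IsAttached.card_adj_le_of_path (hQ : G.IsAttached S Q) (hS : G.IsMaxCoreFree S)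
    (hω : 2 ≤ G.cliqueNum) (hxS : x ∈ S) (hmS : m ∈ S) (hyS : y ∈ S) (hxy : x ≠ y)
    (hxm : G.Adj x m) (hym : G.Adj y m) (hx : ∀ z ∈ S, G.Adj x z → z = m)
    (hy : ∀ z ∈ S, G.Adj y z → z = m) (hm : ∀ z ∈ S, G.Adj m z → z = x ∨ z = y) :
    #{u ∈ Q | G.Adj x u} + #{u ∈ Q | G.Adj m u} + #{u ∈ Q | G.Adj y u} + 4 ≤
      3 * G.cliqueNum := by
  -- At most one edge of the path lies in triangles with `Q`; by symmetry it is not `my`. Then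
  -- `Q`-neighbours of `m` or of `y` all see `x`, and none sees both.
  wlog h : ∀ u ∈ Q, ¬ (G.Adj m u ∧ G.Adj y u) generalizing x y
  · have := this hyS hxS hxy.symm hym hxm hy hx (fun z hz h => (hm z hz h).symm) ?_
    · omega
    · push Not at h
      obtain ⟨w, hw, hmw, hyw⟩ := h
      rintro u hu ⟨hmu, hxu⟩
      exact hQ.not_adj_both_of_path hS hxS hmS hyS hxy hxm hym hx hy hu hw hxu hmu hmw hyw
  have hle : #{u ∈ Q | G.Adj m u} + #{u ∈ Q | G.Adj y u} ≤ #{u ∈ Q | G.Adj x u} := by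
    rw [← card_union_of_disjoint (disjoint_filter.2 fun u hu h1 h2 => h u hu ⟨h1, h2⟩)]
    refine card_le_card fun u hu => ?_
    simp only [mem_union, mem_filter] at hu ⊢
    have h1 := fun hu => (hQ.adj_of_path (u := u) hS hxS hmS hxm hx hy hm hu).2
    have h2 := fun hu => (hQ.adj_of_path (u := u) hS hyS hmS hym hy hx
      (fun z hz h => (hm z hz h).symm) hu).1
    grind
  have := hQ.card_adj_lt_cliqueNum hS (mem_nonisolated.2 ⟨hxS, m, hmS, hxm⟩)
  omega

/-- Discharging from the leaves of the forest on `S` to their neighbours. -/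
theorem IsAttached.sum_charge_nonneg (hQ : G.IsAttached S Q) (hS : G.IsMaxCoreFree S)
    (hω : 2 ≤ G.cliqueNum) :
    0 ≤ ∑ r ∈ G.nonisolated S,
      (2 * (#{y ∈ S | G.Adj r y} : ℤ) + G.cliqueNum - 4 - #{u ∈ Q | G.Adj r u}) := by
  set N := G.nonisolated S with hN
  set d : V → ℕ := fun r => #{y ∈ S | G.Adj r y} with hd
  set f : V → ℤ := fun r => 2 * (d r : ℤ) + G.cliqueNum - 4 - #{u ∈ Q | G.Adj r u} with hf
  change 0 ≤ ∑ r ∈ N, f r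
  have hNS : ∀ r ∈ N, r ∈ S := fun r hr => (mem_nonisolated.1 hr).1
  have hflow : ∀ r ∈ N, 2 * (d r : ℤ) - 3 ≤ f r := by
    intro r hr
    have := hQ.card_adj_lt_cliqueNum hS hr
    simp only [hf]
    omega
  have hleaf : ∀ r ∈ N, d r = 1 → ∃ y ∈ N, G.Adj r y ∧ ∀ z ∈ S, G.Adj r z → z = y := by
    intro r hr hdr
    obtain ⟨y, hy⟩ := card_eq_one.1 hdr
    have hy' : ∀ z, z ∈ S ∧ G.Adj r z ↔ z = y := fun z => by
      have := Finset.ext_iff.1 hy z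
      simpa using this
    have h1 := (hy' y).2 rfl
    exact ⟨y, mem_nonisolated.2 ⟨h1.1, r, hNS r hr, h1.2.symm⟩, h1.2,
      fun z hz hrz => (hy' z).1 ⟨hz, hrz⟩⟩
  have hpos : ∀ r ∈ N, 1 ≤ d r := fun r hr => by
    obtain ⟨-, y, hy, h⟩ := mem_nonisolated.1 hr
    exact card_pos.2 ⟨y, by simp [hy, h]⟩
  set L : Finset V := {r ∈ N | d r = 1} with hL
  set M : Finset V := {r ∈ N | ¬ d r = 1} with hM
  have hsplit : ∑ r ∈ N, f r = ∑ r ∈ L, f r + ∑ r ∈ M, f r :=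
    (sum_filter_add_sum_filter_not N _ f).symm
  have hmemL : ∀ r, r ∈ L ↔ r ∈ N ∧ d r = 1 := fun r => by simp [hL]
  have hmemM : ∀ r, r ∈ M ↔ r ∈ N ∧ ¬ d r = 1 := fun r => by simp [hM]
  -- Leaves next to a leaf form single-edge components and have nonnegative charge; any other leaf
  -- is charged to its unique neighbour, in `M`.
  have hL' : ∑ m ∈ M, ∑ r ∈ L with G.Adj m r, f r ≤ ∑ r ∈ L, f r := by
    simp only [sum_filter]
    rw [sum_comm]
    refine sum_le_sum fun r hr => ?_
    obtain ⟨hrN, hr1⟩ := (hmemL r).1 hr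
    obtain ⟨y, hyN, hry, huniq⟩ := hleaf r hrN hr1
    by_cases hy1 : d y = 1
    · rw [sum_eq_zero]
      · obtain ⟨x, hxN, hyx, hyu⟩ := hleaf y hyN hy1
        have hxr := hyu r (hNS r hrN) hry.symm
        subst hxr
        have := hQ.card_adj_add_two_le_of_edge hS (hNS _ hrN) (hNS _ hyN) hry huniq hyu
        simp only [hf]
        omega
      · intro m hmM
        rw [if_neg]
        intro hmr
        have := huniq m (hNS m ((hmemM m).1 hmM).1) hmr.symm
        exact ((hmemM m).1 hmM).2 (this ▸ hy1)
    · rw [sum_eq_single y, if_pos hry.symm]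
      · intro m hmM hmy
        rw [if_neg]
        exact fun hmr => hmy (huniq m (hNS m ((hmemM m).1 hmM).1) hmr.symm)
      · exact fun h => absurd ((hmemM y).2 ⟨hyN, hy1⟩) h
  have hM' : 0 ≤ ∑ m ∈ M, (∑ r ∈ L with G.Adj m r, f r + f m) := by
    refine sum_nonneg fun m hmM => ?_
    obtain ⟨hmN, hm1⟩ := (hmemM m).1 hmM
    have hsub : (L.filter fun r => G.Adj m r) ⊆ {y ∈ S | G.Adj m y} := by
      intro r hr
      simp only [mem_filter] at hr ⊢
      exact ⟨hNS r ((hmemL r).1 hr.1).1, hr.2⟩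
    have hcard := card_le_card hsub
    have hfl := hflow m hmN
    have hsum : -(#(L.filter fun r => G.Adj m r) : ℤ) ≤ ∑ r ∈ L with G.Adj m r, f r := by
      rw [show -(#(L.filter fun r => G.Adj m r) : ℤ) =
        ∑ r ∈ L with G.Adj m r, (-1 : ℤ) by simp]
      refine sum_le_sum fun r hr => ?_
      obtain ⟨hr1, hr2⟩ := (hmemL r).1 (mem_filter.1 hr).1
      have := hflow r hr1
      omega
    have hm0 := hpos m hmN
    change _ ≤ d m at hcard
    -- Each leaf lacks at most 1, while `m` has at least 2d(m) - 3. This suffices unless `m` is the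
    -- middle of a three-vertex path component.
    by_cases h2 : d m = 2 ∧ #(L.filter fun r => G.Adj m r) = 2
    · obtain ⟨x, y, hxy, he⟩ := Finset.card_eq_two.1 h2.2
      have heq := eq_of_subset_of_card_le hsub (by rw [h2.2]; exact h2.1.le)
      have hx : x ∈ L ∧ G.Adj m x := by
        rw [← mem_filter (p := fun r => G.Adj m r), he]; simp
      have hy : y ∈ L ∧ G.Adj m y := by
        rw [← mem_filter (p := fun r => G.Adj m r), he]; simp
      have hm : ∀ z ∈ S, G.Adj m z → z = x ∨ z = y := by
        intro z hz hmz
        have : z ∈ ({x, y} : Finset V) := by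
          rw [← he, heq]; simp [hz, hmz]
        simpa using this
      have huniq : ∀ x, x ∈ L ∧ G.Adj m x → ∀ z ∈ S, G.Adj x z → z = m := by
        intro x hx z hz hxz
        obtain ⟨hx1, hx2⟩ := (hmemL x).1 hx.1
        obtain ⟨t, -, -, ht⟩ := hleaf x hx1 hx2
        rw [ht z hz hxz, ht m (hNS m hmN) hx.2.symm]
      have hxN := (hmemL x).1 hx.1
      have hyN := (hmemL y).1 hy.1
      have key := hQ.card_adj_le_of_path hS hω (hNS _ hxN.1) (hNS _ hmN) (hNS _ hyN.1) hxy
        hx.2.symm hy.2.symm (huniq x hx) (huniq y hy) hm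
      rw [he, sum_pair hxy]
      simp only [hf]
      omega
    · omega
  rw [sum_add_distrib] at hM'
  linarith

end SimpleGraph

/-! ### Choosing the attached set and counting degrees -/

namespace SimpleGraph

open Finset

variable {V : Type*} [DecidableEq V] {G : SimpleGraph V} [DecidableRel G.Adj] {S : Finset V}

/-- A maximum core-free set has an attached set consisting of all outer vertices with two
neighbours in `S` and of one vertex with three neighbours in `S` for each isolated vertex of `S`
that has such a neighbour. -/
theorem IsMaxCoreFree.exists_isAttached [Fintype V] (hS : G.IsMaxCoreFree S) :
    ∃ Q, G.IsAttached S Q ∧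
      #Q = #{v ∈ Sᶜ | #{r ∈ S | G.Adj v r} = 2} +
        #{x ∈ S \ G.nonisolated S | ∃ u ∈ Sᶜ, G.Adj x u ∧ #{r ∈ S | G.Adj u r} = 3} := by
  set P : Finset V := {v ∈ Sᶜ | #{r ∈ S | G.Adj v r} = 2} with hP
  set B : Finset V := {x ∈ S \ G.nonisolated S |
    ∃ u ∈ Sᶜ, G.Adj x u ∧ #{r ∈ S | G.Adj u r} = 3} with hB
  have hex : ∀ x, ∃ u, x ∈ B → u ∉ S ∧ G.Adj x u ∧ #{r ∈ S | G.Adj u r} = 3 := by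
    intro x
    by_cases hx : x ∈ B
    · obtain ⟨u, hu, h⟩ := (mem_filter.1 hx).2
      exact ⟨u, fun _ => ⟨mem_compl.1 hu, h⟩⟩
    · exact ⟨x, fun h => absurd h hx⟩
  choose f hf using hex
  have hBI : ∀ x ∈ B, x ∈ S \ G.nonisolated S := fun x hx => (mem_filter.1 hx).1
  -- Two of the three neighbours are non-isolated, leaving room for one isolated neighbour.
  have huniq : ∀ u ∉ S, #{r ∈ S | G.Adj u r} = 3 → ∀ x ∈ S \ G.nonisolated S,
      ∀ y ∈ S \ G.nonisolated S, G.Adj x u → G.Adj y u → x = y := by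
    intro u hu h3 x hx y hy hxu hyu
    have h1 := card_filter_nonisolated_add (G := G) S u
    have h2 := hS.two_le_card_nonisolated hu
    exact card_le_one.1 (show #{x ∈ S \ G.nonisolated S | G.Adj u x} ≤ 1 by omega) x
      (by simpa [hxu.symm] using hx) y (by simpa [hyu.symm] using hy)
  have hPiso : ∀ u ∈ P, ∀ x ∈ S \ G.nonisolated S, ¬ G.Adj x u := by
    intro u hu x hx hxu
    obtain ⟨hu1, hu2⟩ := mem_filter.1 hu
    have h1 := card_filter_nonisolated_add (G := G) S u
    have h2 := hS.two_le_card_nonisolated (mem_compl.1 hu1)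
    have h3 : 0 < #{x ∈ S \ G.nonisolated S | G.Adj u x} :=
      card_pos.2 ⟨x, mem_filter.2 ⟨hx, hxu.symm⟩⟩
    omega
  refine ⟨P ∪ B.image f, ⟨?_, ?_, ?_⟩, ?_⟩
  · intro u hu
    rcases mem_union.1 hu with hu | hu
    · exact mem_compl.1 (mem_filter.1 hu).1
    · obtain ⟨x, hx, rfl⟩ := mem_image.1 hu
      exact (hf x hx).1
  · intro u hu
    have h1 := card_filter_nonisolated_add (G := G) S u
    rcases mem_union.1 hu with hu | hu
    · obtain ⟨hu1, hu2⟩ := mem_filter.1 hu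
      have h2 := hS.two_le_card_nonisolated (mem_compl.1 hu1)
      omega
    · obtain ⟨x, hx, rfl⟩ := mem_image.1 hu
      obtain ⟨hx1, hx2, hx3⟩ := hf x hx
      have h2 := hS.two_le_card_nonisolated hx1
      have h3 : 0 < #{y ∈ S \ G.nonisolated S | G.Adj (f x) y} :=
        card_pos.2 ⟨x, mem_filter.2 ⟨hBI x hx, hx2.symm⟩⟩
      omega
  · intro x hx hi u hu w hw hxu hxw
    have hxI : x ∈ S \ G.nonisolated S := by
      simp only [mem_sdiff, mem_nonisolated, hx, true_and]
      rintro ⟨y, hy, h⟩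
      exact hi y hy h
    have key : ∀ u ∈ P ∪ B.image f, G.Adj x u → u = f x := by
      intro u hu hxu
      rcases mem_union.1 hu with hu | hu
      · exact absurd hxu (hPiso u hu x hxI)
      · obtain ⟨y, hy, rfl⟩ := mem_image.1 hu
        obtain ⟨hy1, hy2, hy3⟩ := hf y hy
        rw [huniq _ hy1 hy3 x hxI y (hBI y hy) hxu hy2]
    rw [key u hu hxu, key w hw hxw]
  · rw [card_union_of_disjoint, card_image_of_injOn]
    · intro x hx y hy hxy
      obtain ⟨hx1, hx2, hx3⟩ := hf x hx
      obtain ⟨hy1, hy2, hy3⟩ := hf y hy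
      rw [← show f x = f y from hxy] at hy2
      exact huniq _ hx1 hx3 x (hBI x hx) y (hBI y hy) hx2 hy2
    · rw [Finset.disjoint_left]
      intro u hu hu'
      obtain ⟨x, hx, rfl⟩ := mem_image.1 hu'
      have := (mem_filter.1 hu).2
      have := (hf x hx).2.2
      omega

variable [Fintype V]

theorem degree_eq_card_add_card_compl (S : Finset V) (r : V) :
    G.degree r = #{y ∈ S | G.Adj r y} + #{v ∈ Sᶜ | G.Adj r v} := by
  rw [← card_union_of_disjoint (disjoint_filter_filter disjoint_compl_right), ← filter_union,
    union_compl, ← card_neighborFinset_eq_degree, neighborFinset_eq_filter]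

theorem two_le_cliqueNum_of_maxDegree_pos (h : 0 < G.maxDegree) : 2 ≤ G.cliqueNum := by
  have : ∃ v, 0 < G.degree v := by
    by_contra! hc
    exact absurd (G.maxDegree_le_of_forall_degree_le 0 hc) (by omega)
  obtain ⟨v, hv⟩ := this
  obtain ⟨w, hw⟩ := (G.degree_pos_iff_exists_adj v).1 hv
  rw [← card_pair hw.ne]
  refine IsClique.card_le_cliqueNum (tc := ?_)
  simp only [coe_insert, coe_singleton]
  exact isClique_pair.2 fun _ => hw

theorem IsMaxCoreFree.six_mul_card_le (hS : G.IsMaxCoreFree S) (hΔ : 0 < G.maxDegree) :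
    6 * Fintype.card V ≤ (2 * G.maxDegree + G.cliqueNum + 2) * #S := by
  have hω := two_le_cliqueNum_of_maxDegree_pos hΔ
  obtain ⟨Q, hQ, hQcard⟩ := hS.exists_isAttached
  set N := G.nonisolated S with hN
  have hNS : N ⊆ S := filter_subset _ _
  set d : V → ℕ := fun r => #{y ∈ S | G.Adj r y} with hd
  set P : Finset V := {v ∈ Sᶜ | #{r ∈ S | G.Adj v r} = 2} with hP
  set B : Finset V := {x ∈ S \ N | ∃ u ∈ Sᶜ, G.Adj x u ∧ #{r ∈ S | G.Adj u r} = 3} with hB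
  set C : Finset V := {x ∈ (S \ N) \ B | G.degree x = G.maxDegree} with hC
  set D : Finset V := {x ∈ (S \ N) \ B | ¬ G.degree x = G.maxDegree} with hD
  have hBCD : #B + #C + #D = #(S \ N) := by
    rw [add_assoc, card_filter_add_card_filter_not, add_comm]
    exact card_sdiff_add_card_eq_card (filter_subset _ _)
  have hNI : #(S \ N) + #N = #S := card_sdiff_add_card_eq_card hNS
  have hiso : ∀ x ∈ S \ N, d x = 0 := by
    intro x hx
    obtain ⟨hxS, hxN⟩ := mem_sdiff.1 hx
    refine card_eq_zero.2 (filter_eq_empty_iff.2 fun y hy h => hxN ?_)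
    exact mem_nonisolated.2 ⟨hxS, y, hy, h⟩
  have hCI : ∀ x ∈ C, x ∈ S \ N := fun x hx => (mem_sdiff.1 (mem_filter.1 hx).1).1
  have hDS : ∀ x ∈ D, x ∈ S := fun x hx =>
    (mem_sdiff.1 (mem_sdiff.1 (mem_filter.1 hx).1).1).1
  have hCnbr : ∀ x ∈ C, ∀ v ∈ Sᶜ, G.Adj v x → 4 ≤ d v := by
    intro x hx v hv hvx
    have h1 : #{r ∈ N | G.Adj v r} + #{x ∈ S \ N | G.Adj v x} = d v :=
      card_filter_nonisolated_add (G := G) S v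
    have h2 : 2 ≤ #{r ∈ N | G.Adj v r} := hS.two_le_card_nonisolated (mem_compl.1 hv)
    have h3 : 0 < #{x ∈ S \ N | G.Adj v x} :=
      card_pos.2 ⟨x, mem_filter.2 ⟨hCI x hx, hvx⟩⟩
    have h4 : d v ≠ 3 := fun h => (mem_sdiff.1 (mem_filter.1 hx).1).2
      (mem_filter.2 ⟨hCI x hx, v, hv, hvx.symm, h⟩)
    omega
  have hdeg : ∀ r, G.degree r = d r + #{v ∈ Sᶜ | G.Adj r v} := degree_eq_card_add_card_compl S
  have hswap : ∀ T : Finset V, ∑ r ∈ T, #{v ∈ Sᶜ | G.Adj r v} = ∑ v ∈ Sᶜ, #{r ∈ T | G.Adj v r} := by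
    intro T
    have := sum_card_bipartiteAbove_eq_sum_card_bipartiteBelow (s := T) (t := Sᶜ) G.Adj
    simp only [bipartiteAbove, bipartiteBelow] at this
    rw [this]
    simp only [G.adj_comm]
  have hCsum : ∑ v ∈ Sᶜ, #{x ∈ C | G.Adj v x} = G.maxDegree * #C := by
    rw [← hswap, sum_congr rfl (g := fun _ => G.maxDegree)]
    · simp [mul_comm]
    · intro x hx
      have := hdeg x
      rw [hiso x (hCI x hx), (mem_filter.1 hx).2] at this
      omega
  -- If `C` is nonempty, an outer neighbour of one of its vertices has degree at least 4, so Δ ≥ 4.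
  have hC4 : 4 * #C ≤ G.maxDegree * #C := by
    rcases C.eq_empty_or_nonempty with h | ⟨x, hx⟩
    · simp [h]
    · refine Nat.mul_le_mul_right _ ?_
      have h1 := hdeg x
      rw [hiso x (hCI x hx), (mem_filter.1 hx).2, zero_add] at h1
      obtain ⟨v, hv⟩ := card_pos.1 (h1 ▸ hΔ)
      obtain ⟨hvS, hxv⟩ := mem_filter.1 hv
      have h2 := hCnbr x hx v hvS hxv.symm
      have h3 := hdeg v
      have h4 := G.degree_le_maxDegree v
      omega
  have hout : 4 * (3 * #Sᶜ + #C) ≤ 4 * (∑ v ∈ Sᶜ, d v + #P) := by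
    -- Each vertex of `C` spreads a total of Δ ≥ 4 over its neighbours, hence the scaling by 4. Only
    -- outer vertices with d ≥ 4 receive any, and they can pay: 12 + d ≤ 4d.
    have hpt : ∀ v ∈ Sᶜ, 12 + #{x ∈ C | G.Adj v x} ≤ 4 * d v + (if d v = 2 then 4 else 0) := by
      intro v hv
      have h2 : 2 ≤ #{r ∈ N | G.Adj v r} := hS.two_le_card_nonisolated (mem_compl.1 hv)
      have h3 : #{r ∈ N | G.Adj v r} ≤ d v := card_le_card (filter_subset_filter _ hNS)
      have h4 : #{x ∈ C | G.Adj v x} ≤ d v := card_le_card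
        (filter_subset_filter _ fun x hx => (mem_sdiff.1 (hCI x hx)).1)
      by_cases h5 : 4 ≤ d v
      · omega
      · have h6 : #{x ∈ C | G.Adj v x} = 0 :=
          card_eq_zero.2 (filter_eq_empty_iff.2 fun x hx h => h5 (hCnbr x hx v hv h))
        split_ifs <;> omega
    have := sum_le_sum hpt
    rw [sum_add_distrib, sum_add_distrib, hCsum, ← sum_filter, sum_const, sum_const, ← mul_sum,
      smul_eq_mul, smul_eq_mul] at this
    change _ ≤ _ + #P * 4 at this
    omega
  have hSsum : ∑ r ∈ S, d r = ∑ r ∈ N, d r := by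
    rw [← sum_sdiff hNS, sum_eq_zero hiso, zero_add]
  have hΔsum : ∑ r ∈ N, d r + ∑ v ∈ Sᶜ, d v + #D ≤ G.maxDegree * #S := by
    have h1 : ∀ r ∈ S, G.degree r + (if r ∈ D then 1 else 0) ≤ G.maxDegree := by
      intro r _
      have := G.degree_le_maxDegree r
      split_ifs with h
      · have := (mem_filter.1 h).2
        omega
      · omega
    have h2 := sum_le_sum h1
    rw [sum_add_distrib, sum_congr rfl (fun r _ => hdeg r), sum_add_distrib, hswap, hSsum,
      sum_const, smul_eq_mul, mul_comm, ← sum_filter, sum_const, smul_eq_mul, mul_one,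
      filter_mem_eq_inter, inter_eq_right.2 hDS] at h2
    exact h2
  have hNsum : (2 * #Q : ℤ) + 4 * #N ≤ 2 * ∑ r ∈ N, d r + G.cliqueNum * #N := by
    have h1 := hQ.sum_charge_nonneg hS hω
    have h2 := hQ.sum_card_adj
    rw [sum_sub_distrib, sum_sub_distrib, sum_add_distrib, ← mul_sum, sum_const, sum_const,
      ← Nat.cast_sum, ← Nat.cast_sum, h2] at h1
    simp only [nsmul_eq_mul] at h1
    push_cast at h1 ⊢
    change 0 ≤ 2 * ∑ r ∈ N, (d r : ℤ) + _ - _ - _ at h1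
    linarith
  have hn : #Sᶜ + #S = Fintype.card V := by
    rw [add_comm]; exact card_add_card_compl S
  have hω' : 2 * #(S \ N) ≤ G.cliqueNum * #(S \ N) := Nat.mul_le_mul_right _ hω
  zify at *
  -- Twice `hΔsum`, half of `hout` and `hNsum` combine; ω ≥ 2 is used on the isolated vertices.
  rw [← hn, add_mul, add_mul, mul_assoc, ← hNI, mul_add (G.cliqueNum : ℤ), hNI]
  linarith

end SimpleGraph

/-! ### The bound for `acyclicNumber` and sharpness for cliques -/

theorem IsAcyclicSet.card_le_acyclicNumber {V : Type*} [Fintype V] {G : SimpleGraph V}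
    {S : Finset V} (h : IsAcyclicSet G S) : S.card ≤ acyclicNumber G :=
  le_csSup ⟨Fintype.card V, by rintro k ⟨T, -, rfl⟩; exact Finset.card_le_univ T⟩ ⟨S, h, rfl⟩

theorem IsAcyclicSet.card_le_two {V : Type*} {S : Finset V}
    (h : IsAcyclicSet (⊤ : SimpleGraph V) S) : S.card ≤ 2 := by
  obtain ⟨c⟩ := SimpleGraph.IsAcyclic.colorable_two h
  have hinj : Function.Injective c := by
    intro a b hab
    by_contra hne
    exact c.valid (v := a) (w := b) (fun h => hne (Subtype.ext h)) hab
  simpa using Fintype.card_le_of_injective c hinj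

theorem acyclicNumber_top_le_two (V : Type*) : acyclicNumber (⊤ : SimpleGraph V) ≤ 2 :=
  csSup_le' (by rintro k ⟨S, hS, rfl⟩; exact hS.card_le_two)

theorem theorem1p9 {V : Type*} [Fintype V] (G : SimpleGraph V) [DecidableRel G.Adj]
    (hΔ : 0 < G.maxDegree) :
    (6 * (Fintype.card V : ℝ)) / (2 * (G.maxDegree : ℝ) + (G.cliqueNum : ℝ) + 2)
        ≤ (acyclicNumber G : ℝ) ∧
      (G = ⊤ →
        (acyclicNumber G : ℝ) =
          (6 * (Fintype.card V : ℝ)) / (2 * (G.maxDegree : ℝ) + (G.cliqueNum : ℝ) + 2)) := by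
  classical
  have hlower : (6 * (Fintype.card V : ℝ)) / (2 * (G.maxDegree : ℝ) + (G.cliqueNum : ℝ) + 2)
      ≤ (acyclicNumber G : ℝ) := by
    obtain ⟨S, hS⟩ := G.exists_isMaxCoreFree
    rw [div_le_iff₀ (by positivity), mul_comm (acyclicNumber G : ℝ)]
    exact_mod_cast (hS.six_mul_card_le hΔ).trans
      (Nat.mul_le_mul_left _ hS.coreFree.isAcyclicSet.card_le_acyclicNumber)
  refine ⟨hlower, fun hG => le_antisymm ?_ hlower⟩
  have hle : acyclicNumber G ≤ 2 := hG ▸ acyclicNumber_top_le_two V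
  refine (show (acyclicNumber G : ℝ) ≤ 2 by exact_mod_cast hle).trans ?_
  -- The quotient is at least 2 because Δ + 1 ≤ n and ω ≤ n; completeness served only for `hle`.
  rw [le_div_iff₀ (by positivity)]
  have hdeg : G.maxDegree + 1 ≤ Fintype.card V := by
    have : Nonempty V := by
      by_contra h
      rw [not_nonempty_iff] at h
      simp at hΔ
    exact G.maxDegree_lt_card_verts
  have hclique : G.cliqueNum ≤ Fintype.card V := by
    obtain ⟨s, hs⟩ := G.exists_isNClique_cliqueNum
    exact hs.card_eq ▸ s.card_le_univ
  have hdeg' : (G.maxDegree : ℝ) + 1 ≤ Fintype.card V := by exact_mod_cast hdeg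
  have hclique' : (G.cliqueNum : ℝ) ≤ Fintype.card V := by exact_mod_cast hclique
  linarith
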